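/- Let $f,g$ be real functions that are analytic in a neighborhood of $0$, with $x\,g(x)>0$ for $x\neq 0$ near $0$, normalized by $g'(0)=1$. Put $F(x)=\int_0^x f(s)\,ds$ and $\phi(x)=\int_0^x e^{F(s)}\,ds$, and for $x$ near $0$ let $X=X(x)$ be defined by $\tfrac12X^2=\int_0^x g(s)e^{2F(s)}\,ds$ and $X/\phi(x)>0$ for $x\ne0$ (and $X(0)=0$). The equation $$\ddot x+f(x)\dot x^2+g(x)=0$$ is said to have an isochronous center at $0$ if the origin is a stationary point of the system $\dot x=y,\ \dot y=-g(x)-f(x)y^2$ with arbitrarily small invariant neighborhoods in which all orbits other than the origin are closed, with the same minimal period. Then: (1) The equation has an isochronous center at $0$ if and only if there is a function $h$, odd near $0$, such that for all $x$ near $0$ $$\frac{X}{1+h(X)}=g(x)e^{F(x)}\qquad\text{and}\qquad \phi(x)=X+\int_0^X h(t)\,dt .$$ Every such $h$ is analytic at $0$. (2) In particular, if $f$ and $g$ are odd near $0$, then $0$ is an isochronous center if and only if $g(x)=e^{-F(x)}\phi(x)$ for all $x$ near $0$, or equivalently if and only if the conditions in (1) hold with $h\equiv0$; and every $h$ as in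 (1) vanishes identically near $0$. -/

import Mathlib

open Filter Topology

namespace Lienard

/-- `γ` is a non-constant closed orbit, with minimal period `T`, of the planar system
`(x, y)' = V (x, y)`. -/
def IsClosedOrbit (V : ℝ × ℝ → ℝ × ℝ) (γ : ℝ → ℝ × ℝ) (T : ℝ) : Prop :=
  (∀ t, HasDerivAt γ (V (γ t)) t) ∧ IsLeast {S : ℝ | 0 < S ∧ Function.Periodic γ S} T

/-- The point `p₀` is an isochronous center of the planar system `(x, y)' = V (x, y)`: it is a
stationary point and it has (arbitrarily small) invariant neighbourhoods in which every orbit other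
than `p₀` itself is closed, with a minimal period `T` that is the same for all these orbits.
Since the neighbourhoods are arbitrarily small, only the values of `V` near `p₀` matter. -/
def IsIsochronousCenter (V : ℝ × ℝ → ℝ × ℝ) (p₀ : ℝ × ℝ) : Prop :=
  V p₀ = 0 ∧ ∃ T : ℝ, 0 < T ∧ ∀ W ∈ 𝓝 p₀, ∃ U ∈ 𝓝 p₀, U ⊆ W ∧
    ∀ p ∈ U, p ≠ p₀ → ∃ γ : ℝ → ℝ × ℝ, γ 0 = p ∧ (∀ t, γ t ∈ U) ∧ IsClosedOrbit V γ T

/-- The planar system `x' = y`, `y' = -g(x) - f(x) y²` equivalent to the second order equation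
`x'' + f(x) x'² + g(x) = 0`. -/
def field (f g : ℝ → ℝ) (p : ℝ × ℝ) : ℝ × ℝ :=
  (p.2, -g p.1 - f p.1 * p.2 ^ 2)

/-- `F(x) = ∫₀ˣ f(s) ds`. -/
noncomputable def F (f : ℝ → ℝ) (x : ℝ) : ℝ :=
  ∫ s in (0 : ℝ)..x, f s

/-- `φ(x) = ∫₀ˣ e^{F(s)} ds`. -/
noncomputable def phi (f : ℝ → ℝ) (x : ℝ) : ℝ :=
  ∫ s in (0 : ℝ)..x, Real.exp (F f s)

/-- The function `X(x)` with `½ X² = ∫₀ˣ g(s) e^{2F(s)} ds` and `X / φ(x) > 0` for `x ≠ 0`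
(the integral is nonnegative for `x` near `0` when `s g(s) > 0` for `s ≠ 0` near `0`). -/
noncomputable def X (f g : ℝ → ℝ) (x : ℝ) : ℝ :=
  Real.sign (phi f x) * Real.sqrt (2 * ∫ s in (0 : ℝ)..x, g s * Real.exp (2 * F f s))

/-- `h` is odd near `0` and, for all `x` near `0`, with `X = X(x)`,
`X / (1 + h(X)) = g(x) e^{F(x)}` and `φ(x) = X + ∫₀^X h(t) dt`.
(If `x g(x) > 0` for `x ≠ 0`, the first identity forces `1 + h(X) > 0`: it can only hold with a
nonzero denominator for `x ≠ 0`, and `h(0) = 0` by oddness.) -/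
def IsUrabeFunction (f g h : ℝ → ℝ) : Prop :=
  (∀ᶠ s in 𝓝 (0 : ℝ), h (-s) = -h s) ∧
  (∀ᶠ x in 𝓝 (0 : ℝ), X f g x / (1 + h (X f g x)) = g x * Real.exp (F f x)) ∧
  (∀ᶠ x in 𝓝 (0 : ℝ), phi f x = X f g x + ∫ t in (0 : ℝ)..(X f g x), h t)

end Lienard

/-! In the coordinates `s = X(x)`, `v = e^{F(x)} y` the system becomes `s' = v / (1 + H(s))`, `v' =
-s / (1 + H(s))`, where `ξ` is the local inverse of `X` and `1 + H(s) = ξ'(s) e^{F(ξ(s))}`. The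
orbits are therefore circles `s = ρ sin θ`, `v = ρ cos θ`, run through with `θ' = 1 / (1 + H(ρ sin
θ))`, and the minimal period is `∫₀^{2π} (1 + H(ρ sin α)) dα` (`exists_closedOrbit`).

The odd part of `H` contributes nothing to this integral. Conversely, if the period does not depend
on `ρ`, the even part of `H` minus a constant is an analytic germ with zero mean over all small
circles; such a germ vanishes (`eventually_eq_zero_of_integral_mul_sin`), and `H(0) = 0` makes the
constant zero. So the center is isochronous exactly when `H` is odd.

The first Urabe identity forces `h = H` near `0` (`eventuallyEq_of_isUrabeFunction`), so an odd `h`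
exists iff `H` is odd, and `h` is analytic. If `f` and `g` are odd, then `H` is even as well, so an
odd `H` is zero. -/

namespace Lienard

/-! ### Primitives of analytic germs -/

theorem _root_.AnalyticAt.primitive {f : ℝ → ℝ} (hf : AnalyticAt ℝ f 0) :
    AnalyticAt ℝ (fun x => ∫ s in (0 : ℝ)..x, f s) 0 := by
  obtain ⟨p, hp⟩ := hf
  rw [hasFPowerSeriesAt_iff] at hp
  obtain ⟨r, hr, hs⟩ := Metric.eventually_nhds_iff.1 hp
  simp only [dist_zero_right, zero_add, smul_eq_mul, Real.norm_eq_abs] at hs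
  -- At `n = 0` the coefficient is `p.coeff 0 / 0 = 0`, the vanishing constant term of the
  -- primitive.
  refine ⟨FormalMultilinearSeries.ofScalars ℝ (fun n => p.coeff (n - 1) / n), ?_⟩
  rw [hasFPowerSeriesAt_iff]
  refine Metric.eventually_nhds_iff.2 ⟨r, hr, fun z hz => ?_⟩
  simp only [dist_zero_right, Real.norm_eq_abs] at hz
  simp only [zero_add, smul_eq_mul, FormalMultilinearSeries.coeff_ofScalars]
  have hle : ∀ t ∈ Set.uIoc 0 z, |t| ≤ |z| := fun t ht => by
    have := Set.abs_sub_left_of_mem_uIcc (Set.uIoc_subset_uIcc ht)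
    simpa using this
  have key : HasSum (fun n => ∫ t in (0 : ℝ)..z, t ^ n * p.coeff n) (∫ t in (0 : ℝ)..z, f t) := by
    refine intervalIntegral.hasSum_integral_of_dominated_convergence
      (fun n _ => |z ^ n * p.coeff n|) (fun n => ?_) (fun n => ?_) ?_ ?_ ?_
    · exact (by fun_prop : Continuous fun t : ℝ => t ^ n * p.coeff n).aestronglyMeasurable
    · refine .of_forall fun t ht => ?_
      rw [Real.norm_eq_abs, abs_mul, abs_mul, abs_pow, abs_pow]
      exact mul_le_mul_of_nonneg_right (pow_le_pow_left₀ (abs_nonneg t) (hle t ht) n) (abs_nonneg _)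
    · exact .of_forall fun t _ => (hs hz).summable.abs
    · exact intervalIntegrable_const
    · exact .of_forall fun t ht => hs ((hle t ht).trans_lt hz)
  rw [← hasSum_nat_add_iff' 1]
  simp only [Finset.sum_range_one, Nat.cast_zero, div_zero, mul_zero, sub_zero,
    Nat.add_sub_cancel]
  have hcoeff : ∀ n : ℕ, z ^ (n + 1) * (p.coeff n / ((n + 1 : ℕ) : ℝ)) =
      ∫ t in (0 : ℝ)..z, t ^ n * p.coeff n := fun n => by
    rw [intervalIntegral.integral_mul_const, integral_pow]
    push_cast
    simp
    ring
  simpa only [hcoeff] using key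

theorem eventually_hasDerivAt_primitive {f : ℝ → ℝ} (hf : AnalyticAt ℝ f 0) :
    ∀ᶠ x in 𝓝 (0 : ℝ), HasDerivAt (fun x => ∫ s in (0 : ℝ)..x, f s) (f x) x := by
  obtain ⟨r, hr, hs⟩ := Metric.eventually_nhds_iff_ball.1 hf.eventually_analyticAt
  have hc : ContinuousOn f (Metric.ball 0 r) := fun y hy => (hs y hy).continuousAt.continuousWithinAt
  filter_upwards [Metric.ball_mem_nhds (0 : ℝ) hr] with x hx
  refine intervalIntegral.integral_hasDerivAt_right ?_ ?_ (hs x hx).continuousAt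
  · exact (hc.mono ((convex_ball (0 : ℝ) r).ordConnected.uIcc_subset
      (Metric.mem_ball_self hr) hx)).intervalIntegrable
  · exact hc.stronglyMeasurableAtFilter Metric.isOpen_ball x hx

theorem eventuallyEq_of_hasDerivAt {a b c : ℝ → ℝ} (ha : ∀ᶠ x in 𝓝 (0 : ℝ), HasDerivAt a (c x) x)
    (hb : ∀ᶠ x in 𝓝 (0 : ℝ), HasDerivAt b (c x) x) (h0 : a 0 = b 0) :
    ∀ᶠ x in 𝓝 (0 : ℝ), a x = b x := by
  obtain ⟨r, hr, hs⟩ := Metric.eventually_nhds_iff_ball.1 (ha.and hb)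
  filter_upwards [Metric.ball_mem_nhds (0 : ℝ) hr] with x hx
  refine Metric.isOpen_ball.eqOn_of_deriv_eq (convex_ball (0 : ℝ) r).isPreconnected
    (fun y hy => (hs y hy).1.differentiableAt.differentiableWithinAt)
    (fun y hy => (hs y hy).2.differentiableAt.differentiableWithinAt)
    (fun y hy => ?_) (Metric.mem_ball_self hr) h0 hx
  rw [(hs y hy).1.deriv, (hs y hy).2.deriv]

/-! ### Analyticity of `X` at the origin -/

section Germs

variable {f g : ℝ → ℝ}

theorem F_zero : F f 0 = 0 := by simp [F]

theorem phi_zero : phi f 0 = 0 := by simp [phi]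

theorem X_zero : X f g 0 = 0 := by simp [X]

theorem analyticAt_F (hf : AnalyticAt ℝ f 0) : AnalyticAt ℝ (F f) 0 := hf.primitive

theorem hasDerivAt_F (hf : AnalyticAt ℝ f 0) :
    ∀ᶠ x in 𝓝 (0 : ℝ), HasDerivAt (F f) (f x) x := eventually_hasDerivAt_primitive hf

theorem hasDerivAt_phi (hf : AnalyticAt ℝ f 0) :
    ∀ᶠ x in 𝓝 (0 : ℝ), HasDerivAt (phi f) (Real.exp (F f x)) x :=
  eventually_hasDerivAt_primitive (analyticAt_F hf).rexp

/-- Near `0`, the function `φ` has the sign of its argument. -/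
theorem sign_phi (hf : AnalyticAt ℝ f 0) :
    ∀ᶠ x in 𝓝 (0 : ℝ), Real.sign (phi f x) = Real.sign x := by
  obtain ⟨r, hr, hs⟩ := Metric.eventually_nhds_iff_ball.1 (hasDerivAt_phi hf)
  have hmono : StrictMonoOn (phi f) (Metric.ball 0 r) := by
    refine strictMonoOn_of_deriv_pos (convex_ball _ _)
      (fun y hy => (hs y hy).continuousAt.continuousWithinAt) fun y hy => ?_
    rw [(hs y (interior_subset hy)).deriv]
    exact Real.exp_pos _
  filter_upwards [Metric.ball_mem_nhds (0 : ℝ) hr] with x hx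
  have h0 := Metric.mem_ball_self (x := (0 : ℝ)) hr
  rcases lt_trichotomy x 0 with h | h | h
  · rw [Real.sign_of_neg h, Real.sign_of_neg]
    simpa [phi_zero] using hmono hx h0 h
  · rw [h, phi_zero]
  · rw [Real.sign_of_pos h, Real.sign_of_pos]
    simpa [phi_zero] using hmono h0 hx h

theorem g_zero (hg : AnalyticAt ℝ g 0) (hpos : ∀ᶠ x in 𝓝[≠] (0 : ℝ), 0 < x * g x) : g 0 = 0 := by
  have hc := hg.continuousAt.tendsto
  refine le_antisymm ?_ ?_
  · refine le_of_tendsto (hc.mono_left (nhdsWithin_le_nhds (s := Set.Iio 0))) ?_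
    filter_upwards [nhdsWithin_mono 0 (fun x (hx : x < 0) => hx.ne) hpos, self_mem_nhdsWithin]
      with x hx (h : x < 0)
    exact (neg_of_mul_pos_right hx h.le).le
  · refine ge_of_tendsto (hc.mono_left (nhdsWithin_le_nhds (s := Set.Ioi 0))) ?_
    filter_upwards [nhdsWithin_mono 0 (fun x (hx : 0 < x) => hx.ne') hpos, self_mem_nhdsWithin]
      with x hx (h : 0 < x)
    exact (pos_of_mul_pos_right hx h.le).le

theorem analyticAt_force (hf : AnalyticAt ℝ f 0) (hg : AnalyticAt ℝ g 0) :
    AnalyticAt ℝ (fun s => g s * Real.exp (2 * F f s)) 0 :=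
  hg.mul (analyticAt_const.mul (analyticAt_F hf)).rexp

/-- The potential energy `∫ g e^{2F}` is `x² / 2` times an analytic function with value `1`. -/
theorem exists_potential_eq (hf : AnalyticAt ℝ f 0) (hg : AnalyticAt ℝ g 0)
    (hpos : ∀ᶠ x in 𝓝[≠] (0 : ℝ), 0 < x * g x) (hg1 : deriv g 0 = 1) :
    ∃ q : ℝ → ℝ, AnalyticAt ℝ q 0 ∧ q 0 = 1 ∧
      ∀ x, 2 * ∫ s in (0 : ℝ)..x, g s * Real.exp (2 * F f s) = x ^ 2 * q x := by
  have hforce := analyticAt_force hf hg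
  set P : ℝ → ℝ := fun x => 2 * ∫ s in (0 : ℝ)..x, g s * Real.exp (2 * F f s) with hPdef
  have hP : AnalyticAt ℝ P 0 := analyticAt_const.mul hforce.primitive
  have hP' : ∀ᶠ x in 𝓝 (0 : ℝ), HasDerivAt P (2 * (g x * Real.exp (2 * F f x))) x :=
    (eventually_hasDerivAt_primitive hforce).mono fun x hx => hx.const_mul 2
  have hdslope : ∀ {u : ℝ → ℝ}, AnalyticAt ℝ u 0 → AnalyticAt ℝ (dslope u 0) 0 :=
    fun ⟨p, hp⟩ => ⟨_, hp.has_fpower_series_dslope_fslope⟩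
  have hP0 : P 0 = 0 := by simp [hPdef]
  have hP0' : dslope P 0 0 = 0 := by
    rw [dslope_same, hP'.self_of_nhds.deriv, g_zero hg hpos]; simp
  have hq := hdslope (hdslope hP)
  set q := dslope (dslope P 0) 0 with hqdef
  have hPq : ∀ x, P x = x ^ 2 * q x := fun x => by
    have h1 := sub_smul_dslope P 0 x
    have h2 := sub_smul_dslope (dslope P 0) 0 x
    rw [hP0', ← hqdef] at h2
    simp only [hP0, sub_zero, smul_eq_mul] at h1 h2
    rw [← h1, ← h2]; ring
  refine ⟨q, hq, ?_, hPq⟩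
  -- Two expressions for the derivative of the doubled potential; differentiating both once more at
  -- `0` gives `2 q(0) = 2 g'(0) = 2`.
  have hq' : ∀ᶠ x in 𝓝 (0 : ℝ), 2 * (g x * Real.exp (2 * F f x)) =
      2 * x * q x + x ^ 2 * deriv q x := by
    filter_upwards [hP', hq.eventually_analyticAt] with x hx hqx
    rw [funext hPq] at hx
    refine hx.unique ?_
    simpa using (hasDerivAt_pow 2 x).fun_mul hqx.differentiableAt.hasDerivAt
  have h1 : HasDerivAt (fun x => 2 * (g x * Real.exp (2 * F f x))) 2 0 := by
    have := (hg.differentiableAt.hasDerivAt.mul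
      ((hasDerivAt_F hf).self_of_nhds.const_mul 2).exp).const_mul 2
    simpa [hg1, g_zero hg hpos, F_zero] using this
  have h2 : HasDerivAt (fun x => 2 * x * q x + x ^ 2 * deriv q x) (2 * q 0) 0 := by
    have := (((hasDerivAt_id' (0 : ℝ)).const_mul 2).fun_mul hq.differentiableAt.hasDerivAt).fun_add
      ((hasDerivAt_pow 2 (0 : ℝ)).fun_mul hq.deriv.differentiableAt.hasDerivAt)
    simpa using this
  have := (h2.congr_of_eventuallyEq hq').unique h1
  linarith

/-- The sign of `φ` turns `√(x²) = |x|` back into `x`. This removes the apparent singularity of the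
square root: with `q(0) = 1`, the right-hand side is analytic. -/
theorem X_eventuallyEq (hf : AnalyticAt ℝ f 0) {q : ℝ → ℝ}
    (hPq : ∀ x, 2 * ∫ s in (0 : ℝ)..x, g s * Real.exp (2 * F f s) = x ^ 2 * q x) :
    X f g =ᶠ[𝓝 0] fun x => x * √(q x) := by
  filter_upwards [sign_phi hf] with x hx
  rw [X, hx, hPq, Real.sqrt_mul (sq_nonneg x), Real.sqrt_sq_eq_abs, ← mul_assoc]
  congr 1
  rcases lt_trichotomy x 0 with h | h | h
  · rw [Real.sign_of_neg h, abs_of_neg h]; ring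
  · simp [h]
  · rw [Real.sign_of_pos h, abs_of_pos h]; ring

theorem analyticAt_X (hf : AnalyticAt ℝ f 0) (hg : AnalyticAt ℝ g 0)
    (hpos : ∀ᶠ x in 𝓝[≠] (0 : ℝ), 0 < x * g x) (hg1 : deriv g 0 = 1) :
    AnalyticAt ℝ (X f g) 0 ∧ deriv (X f g) 0 = 1 ∧
      ∀ᶠ x in 𝓝 (0 : ℝ), X f g x * deriv (X f g) x = g x * Real.exp (2 * F f x) := by
  obtain ⟨q, hq, hq0, hPq⟩ := exists_potential_eq hf hg hpos hg1
  have hX := X_eventuallyEq hf hPq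
  have hs : AnalyticAt ℝ (fun x => √(q x)) 0 := by
    have h1 : AnalyticAt ℝ Real.sqrt (q 0) := by
      exact (Real.contDiffAt_sqrt (by simp [hq0])).analyticAt
    exact h1.comp hq
  have hXa : AnalyticAt ℝ (X f g) 0 := (analyticAt_id.mul hs).congr hX.symm
  refine ⟨hXa, ?_, ?_⟩
  · rw [hX.deriv_eq]
    have := ((hasDerivAt_id' (0 : ℝ)).fun_mul hs.differentiableAt.hasDerivAt).deriv
    simpa [hq0] using this
  · have hsq : (fun x => 2 * ∫ s in (0 : ℝ)..x, g s * Real.exp (2 * F f s)) =ᶠ[𝓝 0]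
        fun x => X f g x ^ 2 := by
      filter_upwards [hX, hq.continuousAt.eventually (lt_mem_nhds (by simp [hq0] : (0 : ℝ) < q 0))]
        with x hx hqx
      rw [hPq, hx, mul_pow, Real.sq_sqrt hqx.le]
    filter_upwards [hsq.eventuallyEq_nhds, hXa.eventually_analyticAt,
      eventually_hasDerivAt_primitive (analyticAt_force hf hg)] with x hx hXx hder
    have h1 := (hder.const_mul 2).congr_of_eventuallyEq hx.symm
    have h2 := h1.unique (hXx.differentiableAt.hasDerivAt.pow 2)
    norm_num at h2
    linarith

end Germs

/-! ### The chart straightening the orbits and the germ `H` -/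

/-- `ξ` is the local inverse of `X`, and `H` the germ with `d(φ ∘ ξ)/ds = 1 + H(s)`. -/
structure IsUrabeChart (f g ξ H : ℝ → ℝ) : Prop where
  analyticAt_chart : AnalyticAt ℝ ξ 0
  chart_zero : ξ 0 = 0
  analyticAt_urabe : AnalyticAt ℝ H 0
  urabe_zero : H 0 = 0
  left_inv : ∀ᶠ x in 𝓝 (0 : ℝ), ξ (X f g x) = x
  right_inv : ∀ᶠ s in 𝓝 (0 : ℝ), X f g (ξ s) = s
  hasDerivAt_chart : ∀ᶠ s in 𝓝 (0 : ℝ), HasDerivAt ξ ((1 + H s) * Real.exp (-F f (ξ s))) s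
  force_eq : ∀ᶠ s in 𝓝 (0 : ℝ), (1 + H s) * (g (ξ s) * Real.exp (F f (ξ s))) = s
  phi_eq : ∀ᶠ s in 𝓝 (0 : ℝ), phi f (ξ s) = s + ∫ t in (0 : ℝ)..s, H t

/-- Since `X'(0) = 1`, the inverse function theorem supplies `ξ`, and `H` is then read off from
`ξ'`. The force identity is `X X' = g e^{2F}` at `ξ(s)`, multiplied by `ξ'(s) = 1 / X'(ξ(s))`. -/
theorem exists_isUrabeChart {f g : ℝ → ℝ} (hf : AnalyticAt ℝ f 0) (hg : AnalyticAt ℝ g 0)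
    (hpos : ∀ᶠ x in 𝓝[≠] (0 : ℝ), 0 < x * g x) (hg1 : deriv g 0 = 1) :
    ∃ ξ H : ℝ → ℝ, IsUrabeChart f g ξ H := by
  obtain ⟨hXa, hX1, hXX⟩ := analyticAt_X hf hg hpos hg1
  have hX1' : deriv (X f g) 0 ≠ 0 := by simp [hX1]
  set ξ := hXa.hasStrictDerivAt.localInverse _ _ _ hX1' with hξ
  have hξa : AnalyticAt ℝ ξ 0 := by simpa [X_zero] using hXa.analyticAt_localInverse hX1'
  have hleft : ∀ᶠ x in 𝓝 (0 : ℝ), ξ (X f g x) = x :=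
    HasStrictDerivAt.eventually_left_inverse ..
  have hright : ∀ᶠ s in 𝓝 (0 : ℝ), X f g (ξ s) = s := by
    have := hXa.hasStrictDerivAt.eventually_right_inverse hX1'
    rwa [X_zero] at this
  have hξ0 : ξ 0 = 0 := by simpa [X_zero] using hleft.self_of_nhds
  have htend : Tendsto ξ (𝓝 0) (𝓝 0) := by simpa [hξ0] using hξa.continuousAt.tendsto
  have hprod : ∀ᶠ s in 𝓝 (0 : ℝ), deriv (X f g) (ξ s) * deriv ξ s = 1 := by
    filter_upwards [htend.eventually hXa.eventually_analyticAt, hξa.eventually_analyticAt,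
      hright.eventually_nhds] with s h1 h2 h3
    have h4 := h1.differentiableAt.hasDerivAt.comp s h2.differentiableAt.hasDerivAt
    exact (h4.congr_of_eventuallyEq (h3.mono fun t ht => ht.symm)).unique (hasDerivAt_id' s)
  have hFa : AnalyticAt ℝ (fun s => F f (ξ s)) 0 :=
    AnalyticAt.comp (g := F f) (f := ξ) (by rw [hξ0]; exact analyticAt_F hf) hξa
  set H : ℝ → ℝ := fun s => deriv ξ s * Real.exp (F f (ξ s)) - 1 with hH
  have hHa : AnalyticAt ℝ H 0 := (hξa.deriv.mul hFa.rexp).sub analyticAt_const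
  have hH' : ∀ s, 1 + H s = deriv ξ s * Real.exp (F f (ξ s)) := fun s => by simp [hH]
  have hξ' : ∀ᶠ s in 𝓝 (0 : ℝ), HasDerivAt ξ (deriv ξ s) s :=
    hξa.eventually_analyticAt.mono fun s hs => hs.differentiableAt.hasDerivAt
  refine ⟨ξ, H, hξa, hξ0, hHa, ?_, hleft, hright, ?_, ?_, ?_⟩
  · have := hprod.self_of_nhds
    rw [hξ0, hX1, one_mul] at this
    simp [hH, this, hξ0, F_zero]
  · filter_upwards [hξ'] with s hs
    rwa [hH', mul_assoc, ← Real.exp_add, add_neg_cancel, Real.exp_zero, mul_one]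
  · filter_upwards [hprod, hright, htend.eventually hXX] with s h1 h2 h3
    rw [h2, two_mul, Real.exp_add] at h3
    rw [hH']
    linear_combination (-deriv ξ s) * h3 + s * h1
  · refine eventuallyEq_of_hasDerivAt (c := fun s => 1 + H s) ?_ ?_ (by simp [hξ0, phi_zero])
    · filter_upwards [htend.eventually (hasDerivAt_phi hf), hξ'] with s h1 h2
      rw [hH', mul_comm]
      exact h1.comp s h2
    · filter_upwards [eventually_hasDerivAt_primitive hHa] with s hs
      exact (hasDerivAt_id' s).add hs

namespace IsUrabeChart

variable {f g ξ H : ℝ → ℝ}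

theorem tendsto_chart (c : IsUrabeChart f g ξ H) : Tendsto ξ (𝓝 0) (𝓝 0) := by
  simpa [c.chart_zero] using c.analyticAt_chart.continuousAt.tendsto

theorem tendsto_X (hX : AnalyticAt ℝ (X f g) 0) : Tendsto (X f g) (𝓝 0) (𝓝 0) := by
  simpa [X_zero] using hX.continuousAt.tendsto

theorem one_add_urabe_gt (c : IsUrabeChart f g ξ H) : ∀ᶠ s in 𝓝 (0 : ℝ), 1 / 2 < 1 + H s := by
  have h : ContinuousAt (fun s => 1 + H s) 0 := continuousAt_const.add c.analyticAt_urabe.continuousAt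
  exact h.eventually (lt_mem_nhds (by norm_num [c.urabe_zero]))

/-- At `x = ξ(s)` the first Urabe identity and the force identity both compute `g e^F`, as `s / (1 +
h(s))` and `s / (1 + H(s))`. At `s = 0` this says nothing, and oddness of `h` is used instead. -/
theorem eventuallyEq_of_isUrabeFunction (c : IsUrabeChart f g ξ H) {h : ℝ → ℝ}
    (hh : IsUrabeFunction f g h) : h =ᶠ[𝓝 0] H := by
  have h0 : h 0 = 0 := by
    have := hh.1.self_of_nhds
    rw [neg_zero] at this
    linarith
  filter_upwards [c.tendsto_chart.eventually hh.2.1, c.right_inv, c.force_eq] with s h1 h2 h3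
  rw [h2] at h1
  rcases eq_or_ne s 0 with rfl | hs
  · rw [h0, c.urabe_zero]
  have hG : g (ξ s) * Real.exp (F f (ξ s)) ≠ 0 := fun hG => hs (by rw [← h3, hG, mul_zero])
  -- A zero denominator would make the quotient `0` by convention, contradicting `hG`.
  have hh1 : 1 + h s ≠ 0 := fun hh1 => hG (by rw [← h1, hh1, div_zero])
  rw [div_eq_iff hh1] at h1
  have : g (ξ s) * Real.exp (F f (ξ s)) * (h s - H s) = 0 := by linear_combination -h1 - h3
  linarith [(mul_eq_zero.1 this).resolve_left hG]

theorem isUrabeFunction_of_odd (c : IsUrabeChart f g ξ H) (hX : AnalyticAt ℝ (X f g) 0)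
    (hodd : ∀ᶠ s in 𝓝 (0 : ℝ), H (-s) = -H s) : IsUrabeFunction f g H := by
  have ht := tendsto_X hX
  refine ⟨hodd, ?_, ?_⟩
  · filter_upwards [ht.eventually c.force_eq, ht.eventually c.one_add_urabe_gt, c.left_inv]
      with x h1 h2 h3
    rw [h3] at h1
    rw [div_eq_iff (by linarith), mul_comm, h1]
  · filter_upwards [ht.eventually c.phi_eq, c.left_inv] with x h1 h2
    rwa [h2] at h1

theorem exists_isUrabeFunction_iff (c : IsUrabeChart f g ξ H) (hX : AnalyticAt ℝ (X f g) 0) :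
    (∃ h, IsUrabeFunction f g h) ↔ ∀ᶠ s in 𝓝 (0 : ℝ), H (-s) = -H s := by
  refine ⟨fun ⟨h, hh⟩ => ?_, fun hodd => ⟨H, c.isUrabeFunction_of_odd hX hodd⟩⟩
  have heq := c.eventuallyEq_of_isUrabeFunction hh
  have hneg : Tendsto (fun s : ℝ => -s) (𝓝 0) (𝓝 0) := by
    simpa using (continuous_neg (G := ℝ)).tendsto 0
  filter_upwards [heq, hneg.eventually heq, hh.1] with s h1 h2 h3
  rw [← h1, ← h2, h3]

end IsUrabeChart

/-! ### Odd coefficients -/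

theorem eventually_primitive_neg {u : ℝ → ℝ} {ε : ℝ} (hu : ∀ᶠ x in 𝓝 (0 : ℝ), u (-x) = ε * u x) :
    ∀ᶠ x in 𝓝 (0 : ℝ), ∫ s in (0 : ℝ)..(-x), u s = -ε * ∫ s in (0 : ℝ)..x, u s := by
  obtain ⟨r, hr, hs⟩ := Metric.eventually_nhds_iff_ball.1 hu
  filter_upwards [Metric.ball_mem_nhds (0 : ℝ) hr] with x hx
  have h1 : ∫ s in (0 : ℝ)..x, u (-s) = ∫ s in (0 : ℝ)..x, ε * u s :=
    intervalIntegral.integral_congr fun s hsx => hs s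
      ((convex_ball (0 : ℝ) r).ordConnected.uIcc_subset (Metric.mem_ball_self hr) hx hsx)
  rw [intervalIntegral.integral_comp_neg, neg_zero, intervalIntegral.integral_const_mul] at h1
  rw [intervalIntegral.integral_symm, h1, neg_mul]

section Parity

variable {f g : ℝ → ℝ}

theorem F_even (hf : ∀ᶠ x in 𝓝 (0 : ℝ), f (-x) = -f x) :
    ∀ᶠ x in 𝓝 (0 : ℝ), F f (-x) = F f x := by
  filter_upwards [eventually_primitive_neg (ε := -1) (by simpa using hf)] with x hx
  simpa [F] using hx

theorem phi_odd (hf : ∀ᶠ x in 𝓝 (0 : ℝ), f (-x) = -f x) :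
    ∀ᶠ x in 𝓝 (0 : ℝ), phi f (-x) = -phi f x := by
  have h : ∀ᶠ x in 𝓝 (0 : ℝ), Real.exp (F f (-x)) = 1 * Real.exp (F f x) := by
    filter_upwards [F_even hf] with x hx
    rw [hx, one_mul]
  filter_upwards [eventually_primitive_neg (u := fun x => Real.exp (F f x)) h] with x hx
  simpa [phi] using hx

theorem X_odd (hf : ∀ᶠ x in 𝓝 (0 : ℝ), f (-x) = -f x) (hg : ∀ᶠ x in 𝓝 (0 : ℝ), g (-x) = -g x) :
    ∀ᶠ x in 𝓝 (0 : ℝ), X f g (-x) = -X f g x := by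
  have h : ∀ᶠ x in 𝓝 (0 : ℝ), g (-x) * Real.exp (2 * F f (-x)) =
      -1 * (g x * Real.exp (2 * F f x)) := by
    filter_upwards [F_even hf, hg] with x hx hgx
    rw [hx, hgx]; ring
  filter_upwards [phi_odd hf,
    eventually_primitive_neg (u := fun x => g x * Real.exp (2 * F f x)) h] with x h1 h2
  rw [X, X, h1, h2, Real.sign_neg, neg_neg, one_mul, neg_mul]

/-- The Urabe functions of an equation with odd coefficients vanish near `0`. -/
theorem IsUrabeFunction.eventually_eq_zero_of_odd {ξ H h : ℝ → ℝ} (c : IsUrabeChart f g ξ H)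
    (hf : ∀ᶠ x in 𝓝 (0 : ℝ), f (-x) = -f x) (hg : ∀ᶠ x in 𝓝 (0 : ℝ), g (-x) = -g x)
    (hh : IsUrabeFunction f g h) : ∀ᶠ s in 𝓝 (0 : ℝ), h s = 0 := by
  have hneg : Tendsto (fun s : ℝ => -s) (𝓝 0) (𝓝 0) := by
    simpa using (continuous_neg (G := ℝ)).tendsto 0
  have hc := c.eventuallyEq_of_isUrabeFunction hh
  filter_upwards [hh.1, hc, hneg.eventually hc, c.force_eq, hneg.eventually c.force_eq,
    c.tendsto_chart.eventually (hneg.eventually c.left_inv),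
    c.tendsto_chart.eventually (X_odd hf hg), c.right_inv,
    c.tendsto_chart.eventually (F_even hf), c.tendsto_chart.eventually hg]
    with s h1 h2 h3 h4 h5 h6 h7 h8 h9 h10
  -- Oddness of `X` passes to its inverse: `ξ(-s) = -ξ(s)`. The force identity at `-s` then shows
  -- that `H` is even, while `h = H` is odd.
  rw [h7, h8] at h6
  rw [h6, h10, h9] at h5
  rcases eq_or_ne s 0 with rfl | hs
  · rw [h2, c.urabe_zero]
  have hG : g (ξ s) * Real.exp (F f (ξ s)) ≠ 0 := fun hG => hs (by rw [← h4, hG, mul_zero])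
  have : g (ξ s) * Real.exp (F f (ξ s)) * (H s - H (-s)) = 0 := by linear_combination h4 + h5
  have := (mul_eq_zero.1 this).resolve_left hG
  linarith

theorem IsUrabeFunction.zero_of_eventually_eq_zero {h : ℝ → ℝ} (hX : AnalyticAt ℝ (X f g) 0)
    (hh : IsUrabeFunction f g h) (h0 : ∀ᶠ s in 𝓝 (0 : ℝ), h s = 0) :
    IsUrabeFunction f g fun _ => 0 := by
  have ht := IsUrabeChart.tendsto_X hX
  obtain ⟨r, hr, hs⟩ := Metric.eventually_nhds_iff_ball.1 h0
  refine ⟨by simp, ?_, ?_⟩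
  · filter_upwards [hh.2.1, ht.eventually h0] with x h1 h2
    rwa [h2] at h1
  · filter_upwards [hh.2.2, ht.eventually (Metric.ball_mem_nhds (0 : ℝ) hr)] with x h1 h2
    rw [h1]
    congr 1
    exact intervalIntegral.integral_congr fun s hsx => hs s
      ((convex_ball (0 : ℝ) r).ordConnected.uIcc_subset (Metric.mem_ball_self hr) h2 hsx)

/-- For `h = 0` the two identities read `X = g e^F` and `φ = X`. Conversely, `g = e^{-F} φ` gives `g
e^{2F} = φ φ'`, hence `X² = φ²`, and the sign convention selects `X = φ`. -/
theorem isUrabeFunction_zero_iff (hf : AnalyticAt ℝ f 0) (hg : AnalyticAt ℝ g 0) :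
    IsUrabeFunction f g (fun _ => 0) ↔
      ∀ᶠ x in 𝓝 (0 : ℝ), g x = Real.exp (-F f x) * phi f x := by
  constructor
  · rintro ⟨-, h1, h2⟩
    filter_upwards [h1, h2] with x h1 h2
    simp only [add_zero, div_one, intervalIntegral.integral_zero] at h1 h2
    rw [h2, h1, mul_comm, mul_assoc, ← Real.exp_add, add_neg_cancel, Real.exp_zero, mul_one]
  · intro h
    have hint : ∀ᶠ x in 𝓝 (0 : ℝ),
        ∫ s in (0 : ℝ)..x, g s * Real.exp (2 * F f s) = phi f x ^ 2 / 2 := by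
      refine eventuallyEq_of_hasDerivAt
        (eventually_hasDerivAt_primitive (analyticAt_force hf hg)) ?_ (by simp [phi_zero])
      filter_upwards [hasDerivAt_phi hf, h] with x h1 h2
      have h3 : g x * Real.exp (2 * F f x) = Real.exp (F f x) * phi f x := by
        rw [h2, mul_right_comm, ← Real.exp_add]
        ring_nf
      have h4 := (h1.fun_pow 2).div_const 2
      refine h4.congr_deriv ?_
      rw [h3]
      norm_num
      ring
    have hXphi : ∀ᶠ x in 𝓝 (0 : ℝ), X f g x = phi f x := by
      filter_upwards [hint] with x hx
      rw [X, hx, mul_div_cancel₀ _ two_ne_zero, Real.sqrt_sq_eq_abs]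
      rcases lt_trichotomy (phi f x) 0 with h | h | h
      · rw [Real.sign_of_neg h, abs_of_neg h]; ring
      · simp [h]
      · rw [Real.sign_of_pos h, abs_of_pos h]; ring
    refine ⟨by simp, ?_, ?_⟩
    · filter_upwards [hXphi, h] with x h1 h2
      rw [h1, h2, add_zero, div_one, mul_right_comm, ← Real.exp_add, neg_add_cancel, Real.exp_zero,
        one_mul]
    · filter_upwards [hXphi] with x h1
      simp [h1]

end Parity

/-! ### Closed orbits and their periods -/

/-- A solution of `θ' = 1 / w(θ)`, for a positive function `w` of period `2π`. -/
theorem exists_angle {w : ℝ → ℝ} (hw : Continuous w) (hper : Function.Periodic w (2 * Real.pi))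
    (hlb : ∀ x, 1 / 2 ≤ w x) (θ₀ : ℝ) :
    ∃ θ : ℝ → ℝ, θ 0 = θ₀ ∧ StrictMono θ ∧ (∀ t, HasDerivAt θ (w (θ t))⁻¹ t) ∧
      ∀ t, θ (t + ∫ x in (0 : ℝ)..(2 * Real.pi), w x) = θ t + 2 * Real.pi := by
  -- Time as a function of the angle; the solution `θ` is its inverse.
  set τ : ℝ → ℝ := fun x => ∫ s in θ₀..x, w s with hτ
  have hd : ∀ x, HasDerivAt τ (w x) x := fun x => intervalIntegral.integral_hasDerivAt_right
    (hw.intervalIntegrable _ _) hw.stronglyMeasurable.stronglyMeasurableAtFilter hw.continuousAt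
  have hmono : StrictMono τ := strictMono_of_deriv_pos fun x => by
    rw [(hd x).deriv]; linarith [hlb x]
  have hcont : Continuous τ := continuous_iff_continuousAt.2 fun x => (hd x).continuousAt
  have hτ0 : τ θ₀ = 0 := by simp [hτ]
  -- The bound `w ≥ 1/2` makes `τ` grow at least linearly, hence surjective, so that `θ` exists for
  -- all time.
  have hmono' : Monotone fun x => τ x - x / 2 := by
    have hd' : ∀ x, HasDerivAt (fun x => τ x - x / 2) (w x - 1 / 2) x := fun x =>
      (hd x).sub ((hasDerivAt_id' x).div_const 2)
    refine monotone_of_deriv_nonneg (fun x => (hd' x).differentiableAt) fun x => ?_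
    rw [(hd' x).deriv]; linarith [hlb x]
  have hsurj : Function.Surjective τ := by
    refine hcont.surjective ?_ ?_
    · refine tendsto_atTop_mono' _ ?_ (tendsto_atTop_add_const_right _ (-(θ₀ / 2))
        (tendsto_id.atTop_div_const two_pos))
      filter_upwards [eventually_ge_atTop θ₀] with x hx
      have := hmono' hx
      simp only [hτ0, id] at this ⊢
      linarith
    · refine tendsto_atBot_mono' _ ?_ (tendsto_atBot_add_const_right _ (-(θ₀ / 2))
        (tendsto_id.atBot_div_const two_pos))
      filter_upwards [eventually_le_atBot θ₀] with x hx
      have := hmono' hx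
      simp only [hτ0, id] at this ⊢
      linarith
  set e := hmono.orderIsoOfSurjective τ hsurj with he
  have hτe : ∀ t, τ (e.symm t) = t := fun t => e.apply_symm_apply t
  refine ⟨e.symm, hmono.injective (by rw [hτe, hτ0]), e.symm.strictMono, fun t => ?_, fun t => ?_⟩
  · exact HasDerivAt.of_local_left_inverse e.symm.continuous.continuousAt (hd _)
      (by linarith [hlb (e.symm t)] : 0 < w (e.symm t)).ne' (.of_forall hτe)
  · refine hmono.injective ?_
    have h1 : τ (e.symm t + 2 * Real.pi) =
        τ (e.symm t) + ∫ s in (e.symm t)..(e.symm t + 2 * Real.pi), w s :=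
      (intervalIntegral.integral_add_adjacent_intervals (hw.intervalIntegrable _ _)
        (hw.intervalIntegrable _ _)).symm
    have h2 := hper.intervalIntegral_add_eq (e.symm t) 0
    rw [zero_add] at h2
    rw [hτe, h1, hτe, h2]

/-- The inverse of the map `(x, y) ↦ (X(x), e^{F(x)} y)`, which turns the orbits near the origin
into circles. -/
noncomputable def planeChart (f ξ : ℝ → ℝ) (p : ℝ × ℝ) : ℝ × ℝ :=
  (ξ p.1, Real.exp (-F f (ξ p.1)) * p.2)

variable {f g ξ H : ℝ → ℝ}

/-- By the chain rule, the factor `1 + H` in `ξ'` cancels the angular speed in the first component.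
In the second, `(e^{-F})'` produces the term `-f y²` and the force identity produces `-g`. -/
theorem hasDerivAt_planeChart_circle {ρ : ℝ} {θ : ℝ → ℝ} {t : ℝ}
    (hθ : HasDerivAt θ (1 + H (ρ * Real.sin (θ t)))⁻¹ t) (hne : 1 + H (ρ * Real.sin (θ t)) ≠ 0)
    (hξ : HasDerivAt ξ ((1 + H (ρ * Real.sin (θ t))) * Real.exp (-F f (ξ (ρ * Real.sin (θ t)))))
      (ρ * Real.sin (θ t)))
    (hF : HasDerivAt (F f) (f (ξ (ρ * Real.sin (θ t)))) (ξ (ρ * Real.sin (θ t))))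
    (hg : (1 + H (ρ * Real.sin (θ t))) *
      (g (ξ (ρ * Real.sin (θ t))) * Real.exp (F f (ξ (ρ * Real.sin (θ t))))) =
        ρ * Real.sin (θ t)) :
    HasDerivAt (fun t => planeChart f ξ (ρ * Real.sin (θ t), ρ * Real.cos (θ t)))
      (field f g (planeChart f ξ (ρ * Real.sin (θ t), ρ * Real.cos (θ t)))) t := by
  have hs : HasDerivAt (fun t => ρ * Real.sin (θ t))
      (ρ * (Real.cos (θ t) * (1 + H (ρ * Real.sin (θ t)))⁻¹)) t := hθ.sin.const_mul ρ
  have hc : HasDerivAt (fun t => ρ * Real.cos (θ t))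
      (ρ * (-Real.sin (θ t) * (1 + H (ρ * Real.sin (θ t)))⁻¹)) t := hθ.cos.const_mul ρ
  have h1 : HasDerivAt (fun t => ξ (ρ * Real.sin (θ t))) _ t := HasDerivAt.comp t hξ hs
  have h2 : HasDerivAt (fun t => F f (ξ (ρ * Real.sin (θ t)))) _ t :=
    HasDerivAt.comp (h₂ := F f) t hF h1
  refine (h1.prodMk (h2.neg.exp.mul hc)).congr_deriv ?_
  simp only [field, planeChart, Prod.mk.injEq]
  generalize hσ : ρ * Real.sin (θ t) = σ at *
  set a := 1 + H σ
  set k := Real.exp (-F f (ξ σ)) with hk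
  have hk' : Real.exp (F f (ξ σ)) * k = 1 := by
    rw [hk, ← Real.exp_add, add_neg_cancel, Real.exp_zero]
  constructor
  · field_simp
  · have hgk : g (ξ σ) = k * σ * a⁻¹ := by
      rw [eq_mul_inv_iff_mul_eq₀ hne]
      linear_combination (-(g (ξ σ) * a)) * hk' + k * hg
    simp only [Pi.neg_apply, hσ, ← hk]
    rw [hgk]
    field_simp
    linear_combination -k * hσ

theorem exists_closedOrbit (c : IsUrabeChart f g ξ H) (hf : AnalyticAt ℝ f 0) :
    ∃ r > 0, ∀ ρ, 0 < ρ → ρ < r → ∀ θ₀, ∃ γ : ℝ → ℝ × ℝ,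
      γ 0 = planeChart f ξ (ρ * Real.sin θ₀, ρ * Real.cos θ₀) ∧
      (∀ t, ∃ α, γ t = planeChart f ξ (ρ * Real.sin α, ρ * Real.cos α)) ∧
      IsClosedOrbit (field f g) γ
        (∫ α in (0 : ℝ)..(2 * Real.pi), (1 + H (ρ * Real.sin α))) := by
  obtain ⟨r, hr, hs⟩ := Metric.eventually_nhds_iff_ball.1
    (c.hasDerivAt_chart.and (c.force_eq.and (c.one_add_urabe_gt.and (c.right_inv.and
      ((c.tendsto_chart.eventually (hasDerivAt_F hf)).and
        c.analyticAt_urabe.eventually_analyticAt)))))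
  refine ⟨r, hr, fun ρ hρ hρr θ₀ => ?_⟩
  have hball : ∀ α, ρ * Real.sin α ∈ Metric.ball (0 : ℝ) r := fun α => by
    rw [mem_ball_zero_iff, Real.norm_eq_abs, abs_mul, abs_of_pos hρ]
    exact (mul_le_of_le_one_right hρ.le (Real.abs_sin_le_one α)).trans_lt hρr
  have hw : Continuous fun α => 1 + H (ρ * Real.sin α) := by
    refine continuous_const.add (continuous_iff_continuousAt.2 fun α => ?_)
    exact ContinuousAt.comp (g := H) (f := fun α => ρ * Real.sin α)
      (hs _ (hball α)).2.2.2.2.2.continuousAt (by fun_prop)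
  obtain ⟨θ, hθ0, hθmono, hθ', hθT⟩ := exists_angle hw (fun α => by simp [Real.sin_add_two_pi])
    (fun α => (hs _ (hball α)).2.2.1.le) θ₀
  refine ⟨fun t => planeChart f ξ (ρ * Real.sin (θ t), ρ * Real.cos (θ t)), by simp only [hθ0],
    fun t => ⟨θ t, rfl⟩, fun t => ?_, ⟨?_, fun t => ?_⟩, fun S hS => ?_⟩
  · obtain ⟨h1, h2, h3, -, h5, -⟩ := hs _ (hball (θ t))
    exact hasDerivAt_planeChart_circle (hθ' t) (by linarith) h1 h5 h2
  · have := hθT 0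
    rw [zero_add] at this
    exact hθmono.lt_iff_lt.1 (by rw [this]; linarith [Real.pi_pos])
  · simp only [hθT, Real.sin_add_two_pi, Real.cos_add_two_pi]
  · obtain ⟨hS0, hSper⟩ := hS
    have h0 := hSper 0
    simp only [zero_add, planeChart, Prod.mk.injEq] at h0
    obtain ⟨h1, h2⟩ := h0
    have hsin : Real.sin (θ S) = Real.sin (θ 0) := by
      have := congrArg (X f g) h1
      rw [(hs _ (hball _)).2.2.2.1, (hs _ (hball _)).2.2.2.1] at this
      exact mul_left_cancel₀ hρ.ne' this
    rw [hsin] at h2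
    have hcos := mul_left_cancel₀ hρ.ne' (mul_left_cancel₀ (Real.exp_pos _).ne' h2)
    -- Minimality: a period `S > 0` restores sine and cosine, so `θ` has gained a positive multiple
    -- of `2π`, hence at least one full turn.
    obtain ⟨k, hk⟩ := Real.Angle.angle_eq_iff_two_pi_dvd_sub.1 (Real.Angle.cos_sin_inj hcos hsin)
    have hlt := hθmono hS0
    have hk0 : (0 : ℝ) < k := by
      by_contra! hk0
      nlinarith [Real.pi_pos]
    have hk1 : (1 : ℝ) ≤ k := by exact_mod_cast Int.cast_pos.1 hk0
    have hT := hθT 0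
    rw [zero_add] at hT
    refine hθmono.le_iff_le.1 ?_
    rw [hT]
    nlinarith [Real.pi_pos]

/-! ### Means over circles -/

theorem continuous_comp_mul_sin {u : ℝ → ℝ} {r ρ : ℝ} (hu : ContinuousOn u (Metric.ball 0 r))
    (hρ : 0 < ρ) (hρr : ρ < r) : Continuous fun α => u (ρ * Real.sin α) := by
  refine hu.comp_continuous (by fun_prop) fun α => ?_
  rw [mem_ball_zero_iff, Real.norm_eq_abs, abs_mul, abs_of_pos hρ]
  exact (mul_le_of_le_one_right hρ.le (Real.abs_sin_le_one α)).trans_lt hρr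

/-- The substitution `α ↦ 2π - α` changes the sign of `sin α`. Hence only the even part of a
function contributes to its mean over a circle. -/
theorem integral_comp_neg_mul_sin (u : ℝ → ℝ) (ρ : ℝ) :
    ∫ α in (0 : ℝ)..(2 * Real.pi), u (-(ρ * Real.sin α)) =
      ∫ α in (0 : ℝ)..(2 * Real.pi), u (ρ * Real.sin α) := by
  have h := intervalIntegral.integral_comp_sub_left (a := 0) (b := 2 * Real.pi)
    (fun α => u (ρ * Real.sin α)) (2 * Real.pi)
  simpa [Real.sin_two_pi_sub] using h

theorem _root_.AnalyticAt.exists_continuousOn_ball {u : ℝ → ℝ} (hu : AnalyticAt ℝ u 0) :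
    ∃ r > 0, ContinuousOn u (Metric.ball 0 r) := by
  obtain ⟨r, hr, hs⟩ := Metric.eventually_nhds_iff_ball.1 hu.eventually_analyticAt
  exact ⟨r, hr, fun y hy => (hs y hy).continuousAt.continuousWithinAt⟩

/-- An even analytic germ whose means over small circles vanish is zero. -/
theorem eventually_eq_zero_of_integral_mul_sin {e : ℝ → ℝ} (he : AnalyticAt ℝ e 0)
    (heven : ∀ s, e (-s) = e s)
    (hint : ∀ᶠ ρ in 𝓝[>] (0 : ℝ), ∫ α in (0 : ℝ)..(2 * Real.pi), e (ρ * Real.sin α) = 0) :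
    ∀ᶠ s in 𝓝 (0 : ℝ), e s = 0 := by
  refine he.eventually_eq_zero_or_eventually_ne_zero.resolve_right fun hne => ?_
  obtain ⟨r₁, hr₁, hcont⟩ := he.exists_continuousOn_ball
  obtain ⟨r₂, hr₂, hs⟩ := Metric.eventually_nhds_iff_ball.1 (eventually_nhdsWithin_iff.1 hne)
  obtain ⟨ρ, hρ0, hρ, hρr⟩ := (hint.and (Ioo_mem_nhdsGT (lt_min hr₁ hr₂))).exists
  obtain ⟨hρ₁, hρ₂⟩ := lt_min_iff.1 hρr
  have hIcc : ∀ y ∈ Set.Icc 0 ρ, |y| ≤ ρ := fun y hy => by rw [abs_of_nonneg hy.1]; exact hy.2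
  have hneρ : e ρ ≠ 0 := hs ρ (by simpa [abs_of_pos hρ] using hρ₂) hρ.ne'
  -- The germ `e` has no zero in a punctured neighbourhood of `0`, so by the intermediate value
  -- theorem it keeps the sign of `e ρ` on `(0, ρ]`; at `0` it may vanish.
  have hsign : ∀ x ∈ Set.Icc 0 ρ, 0 ≤ e ρ * e x := by
    intro x hx
    by_contra! hlt
    have hsub : Set.uIcc x ρ ⊆ Set.Icc 0 ρ := by
      rw [Set.uIcc_of_le hx.2]; exact Set.Icc_subset_Icc_left hx.1
    have h0 : (0 : ℝ) ∈ Set.uIcc (e x) (e ρ) := by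
      rw [Set.mem_uIcc]
      rcases mul_neg_iff.1 hlt with ⟨h1, h2⟩ | ⟨h1, h2⟩
      · exact .inl ⟨h2.le, h1.le⟩
      · exact .inr ⟨h1.le, h2.le⟩
    obtain ⟨y, hy, hy0⟩ := intermediate_value_uIcc (hcont.mono fun y hy => by
      simpa using (hIcc y (hsub hy)).trans_lt hρ₁) h0
    by_cases hyz : y = 0
    · rw [Set.uIcc_of_le hx.2] at hy
      have hx0 : x = y := le_antisymm hy.1 (hyz ▸ hx.1)
      rw [hx0, hy0, mul_zero] at hlt
      exact lt_irrefl _ hlt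
    · exact hs y (by simpa using (hIcc y (hsub hy)).trans_lt hρ₂) hyz hy0
  have hpos : 0 < ∫ α in (0 : ℝ)..(2 * Real.pi), e ρ * e (ρ * Real.sin α) := by
    refine intervalIntegral.integral_pos (by positivity)
      (continuous_const.mul (continuous_comp_mul_sin hcont hρ hρ₁)).continuousOn
      (fun α _ => ?_) ⟨Real.pi / 2, ⟨by positivity, by linarith [Real.pi_pos]⟩, ?_⟩
    · rcases le_total 0 (Real.sin α) with h | h
      · exact hsign _ ⟨by positivity, mul_le_of_le_one_right hρ.le (Real.sin_le_one α)⟩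
      · rw [← heven (ρ * Real.sin α)]
        refine hsign _ ⟨by nlinarith, ?_⟩
        nlinarith [Real.neg_one_le_sin α]
    · rw [Real.sin_pi_div_two, mul_one]
      exact mul_self_pos.2 hneρ
  rw [intervalIntegral.integral_const_mul, hρ0, mul_zero] at hpos
  exact lt_irrefl _ hpos

/-! ### Isochronous centers and oddness of `H` -/

namespace IsUrabeChart

theorem planeChart_zero (c : IsUrabeChart f g ξ H) : planeChart f ξ (0, 0) = (0, 0) := by
  simp [planeChart, c.chart_zero]

theorem tendsto_planeChart (c : IsUrabeChart f g ξ H) (hf : AnalyticAt ℝ f 0) :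
    Tendsto (planeChart f ξ) (𝓝 (0, 0)) (𝓝 (0, 0)) := by
  have hfst : Tendsto (fun p : ℝ × ℝ => ξ p.1) (𝓝 (0, 0)) (𝓝 0) :=
    c.tendsto_chart.comp (continuous_fst.tendsto' (0, 0) 0 rfl)
  have hF : Tendsto (fun p : ℝ × ℝ => F f (ξ p.1)) (𝓝 (0, 0)) (𝓝 0) := by
    have := (analyticAt_F hf).continuousAt.tendsto
    rw [F_zero] at this
    exact this.comp hfst
  have hexp := (Real.continuous_exp.tendsto _).comp hF.neg
  have hsnd := hexp.mul (continuous_snd.tendsto' ((0 : ℝ), (0 : ℝ)) 0 rfl)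
  rw [mul_zero] at hsnd
  exact hfst.prodMk_nhds hsnd

/-- The map `(x, y) ↦ (X(x), e^{F(x)} y)` is continuous at the origin and is a local right inverse
of `planeChart`, so the image contains the preimage of `A` under it near the origin. -/
theorem image_planeChart_mem_nhds (c : IsUrabeChart f g ξ H) (hf : AnalyticAt ℝ f 0)
    (hX : AnalyticAt ℝ (X f g) 0) {A : Set (ℝ × ℝ)} (hA : A ∈ 𝓝 ((0 : ℝ), (0 : ℝ))) :
    planeChart f ξ '' A ∈ 𝓝 ((0 : ℝ), (0 : ℝ)) := by
  have hfst : Tendsto (fun p : ℝ × ℝ => p.1) (𝓝 (0, 0)) (𝓝 0) :=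
    continuous_fst.tendsto' (0, 0) 0 rfl
  have hexp := (Real.continuous_exp.tendsto _).comp
    ((analyticAt_F hf).continuousAt.tendsto.comp hfst)
  have hsnd := hexp.mul (continuous_snd.tendsto' ((0 : ℝ), (0 : ℝ)) 0 rfl)
  rw [mul_zero] at hsnd
  filter_upwards [(((tendsto_X hX).comp hfst).prodMk_nhds hsnd).eventually hA,
    hfst.eventually c.left_inv] with p hp hinv
  refine ⟨_, hp, ?_⟩
  simp only [planeChart, Function.comp, hinv, ← mul_assoc, ← Real.exp_add, neg_add_cancel,
    Real.exp_zero, one_mul]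

/-- The invariant neighbourhoods are images of small discs, which are unions of the circular orbits
and the origin. The period is `2π` because the odd `H` has zero mean over each circle. -/
theorem isIsochronousCenter_of_odd (c : IsUrabeChart f g ξ H) (hf : AnalyticAt ℝ f 0)
    (hX : AnalyticAt ℝ (X f g) 0) (hg0 : g 0 = 0)
    (hodd : ∀ᶠ s in 𝓝 (0 : ℝ), H (-s) = -H s) : IsIsochronousCenter (field f g) (0, 0) := by
  refine ⟨by simp [field, hg0], 2 * Real.pi, by positivity, fun W hW => ?_⟩
  obtain ⟨r₁, hr₁, horb⟩ := exists_closedOrbit c hf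
  obtain ⟨r₂, hr₂, hcont⟩ := c.analyticAt_urabe.exists_continuousOn_ball
  obtain ⟨r₃, hr₃, hodd⟩ := Metric.eventually_nhds_iff_ball.1 hodd
  obtain ⟨r₄, hr₄, hmap⟩ := Metric.eventually_nhds_iff_ball.1
    ((c.tendsto_planeChart hf).eventually hW)
  set R := min (min r₁ r₂) (min r₃ r₄) with hR
  have hR0 : 0 < R := by positivity
  set A : Set (ℝ × ℝ) := {p | p.1 ^ 2 + p.2 ^ 2 < R ^ 2} with hA
  have hAnhds : A ∈ 𝓝 ((0 : ℝ), (0 : ℝ)) := by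
    refine (isOpen_lt (by fun_prop) (by fun_prop)).mem_nhds ?_
    simp [hR0]
  refine ⟨planeChart f ξ '' A, c.image_planeChart_mem_nhds hf hX hAnhds, ?_, ?_⟩
  · rintro _ ⟨p, hp, rfl⟩
    rw [hA, Set.mem_ofPred_eq] at hp
    have hRr : R ≤ r₄ := (min_le_right _ _).trans (min_le_right _ _)
    refine hmap p ?_
    rw [Metric.mem_ball, Prod.dist_eq, max_lt_iff]
    simp only [Real.dist_eq, sub_zero]
    exact ⟨(abs_lt_of_sq_lt_sq (by nlinarith) hR0.le).trans_le hRr,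
      (abs_lt_of_sq_lt_sq (by nlinarith) hR0.le).trans_le hRr⟩
  · rintro _ ⟨⟨s, y⟩, hp, rfl⟩ hne
    rw [hA, Set.mem_ofPred_eq] at hp
    -- The coordinates are swapped because the orbits are parametrised by `s = ρ sin θ`, `y = ρ cos
    -- θ`.
    set z : ℂ := ⟨y, s⟩ with hz
    have hz0 : 0 < ‖z‖ := by
      rw [norm_pos_iff]
      intro h0
      have h1 : y = 0 := congrArg Complex.re h0
      have h2 : s = 0 := congrArg Complex.im h0
      exact hne (by rw [h1, h2, c.planeChart_zero])
    have hzR : ‖z‖ < R := by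
      refine lt_of_pow_lt_pow_left₀ 2 hR0.le ?_
      rw [Complex.sq_norm, Complex.normSq_apply]
      simp only [hz]
      nlinarith
    have hy : ‖z‖ * Real.cos z.arg = y := Complex.norm_mul_cos_arg z
    have hs : ‖z‖ * Real.sin z.arg = s := Complex.norm_mul_sin_arg z
    have hz1 : ‖z‖ < r₁ := hzR.trans_le ((min_le_left _ _).trans (min_le_left _ _))
    have hz2 : ‖z‖ < r₂ := hzR.trans_le ((min_le_left _ _).trans (min_le_right _ _))
    have hz3 : ‖z‖ < r₃ := hzR.trans_le ((min_le_right _ _).trans (min_le_left _ _))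
    obtain ⟨γ, hγ0, hγ, hγT⟩ := horb ‖z‖ hz0 hz1 z.arg
    refine ⟨γ, by rw [hγ0, hy, hs], fun t => ?_, ?_⟩
    · obtain ⟨α, hα⟩ := hγ t
      refine ⟨_, ?_, hα.symm⟩
      have := Real.sin_sq_add_cos_sq α
      have h2 : ‖z‖ ^ 2 < R ^ 2 := pow_lt_pow_left₀ hzR hz0.le two_ne_zero
      change (‖z‖ * Real.sin α) ^ 2 + (‖z‖ * Real.cos α) ^ 2 < R ^ 2
      rw [mul_pow, mul_pow, ← mul_add, this, mul_one]
      exact h2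
    · have hc := continuous_comp_mul_sin hcont hz0 hz2
      have hH0 : ∫ α in (0 : ℝ)..(2 * Real.pi), H (‖z‖ * Real.sin α) = 0 := by
        have h1 := integral_comp_neg_mul_sin H ‖z‖
        have h2 : ∀ α, H (-(‖z‖ * Real.sin α)) = -H (‖z‖ * Real.sin α) := fun α => hodd _ (by
          rw [mem_ball_zero_iff, norm_mul, norm_norm]
          exact (mul_le_of_le_one_right hz0.le (Real.abs_sin_le_one α)).trans_lt hz3)
        simp only [h2, intervalIntegral.integral_neg] at h1
        linarith
      rw [intervalIntegral.integral_add (by simp) (hc.intervalIntegrable _ _), hH0] at hγT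
      simpa using hγT

theorem contDiffAt_field (hf : AnalyticAt ℝ f 0) (hg : AnalyticAt ℝ g 0) :
    ContDiffAt ℝ 1 (field f g) (0, 0) := by
  have hf' : ContDiffAt ℝ 1 (fun p : ℝ × ℝ => f p.1) (0, 0) :=
    ContDiffAt.comp (g := f) (0, 0) hf.contDiffAt contDiffAt_fst
  have hg' : ContDiffAt ℝ 1 (fun p : ℝ × ℝ => g p.1) (0, 0) :=
    ContDiffAt.comp (g := g) (0, 0) hg.contDiffAt contDiffAt_fst
  exact contDiffAt_snd.prodMk (hg'.neg.sub (hf'.mul (contDiffAt_snd.pow 2)))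

/-- On a neighbourhood `W` where the field is Lipschitz, the closed orbit given by isochronicity and
the circular orbit through the same point coincide by ODE uniqueness, so their minimal periods
agree. -/
theorem exists_period_eq (c : IsUrabeChart f g ξ H) (hf : AnalyticAt ℝ f 0)
    (hg : AnalyticAt ℝ g 0) (hcen : IsIsochronousCenter (field f g) (0, 0)) :
    ∃ T : ℝ, ∀ᶠ ρ in 𝓝[>] (0 : ℝ),
      ∫ α in (0 : ℝ)..(2 * Real.pi), (1 + H (ρ * Real.sin α)) = T := by
  obtain ⟨K, W, hW, hLip⟩ := (contDiffAt_field hf hg).exists_lipschitzOnWith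
  obtain ⟨-, T, -, hT⟩ := hcen
  obtain ⟨U, hU, hUW, horbU⟩ := hT W hW
  obtain ⟨r₁, hr₁, horb⟩ := exists_closedOrbit c hf
  obtain ⟨r₂, hr₂, hmap⟩ := Metric.eventually_nhds_iff_ball.1
    ((c.tendsto_planeChart hf).eventually (inter_mem hU hW))
  refine ⟨T, ?_⟩
  filter_upwards [Ioo_mem_nhdsGT (lt_min hr₁ hr₂)] with ρ ⟨hρ, hρr⟩
  obtain ⟨hρ₁, hρ₂⟩ := lt_min_iff.1 hρr
  have hmem : ∀ α, planeChart f ξ (ρ * Real.sin α, ρ * Real.cos α) ∈ U ∩ W := fun α => by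
    refine hmap _ ?_
    rw [Metric.mem_ball, Prod.dist_eq, max_lt_iff]
    simp only [Real.dist_eq, sub_zero, abs_mul, abs_of_pos hρ]
    exact ⟨(mul_le_of_le_one_right hρ.le (Real.abs_sin_le_one α)).trans_lt hρ₂,
      (mul_le_of_le_one_right hρ.le (Real.abs_cos_le_one α)).trans_lt hρ₂⟩
  obtain ⟨γ, hγ0, hγ, hγd, hγT⟩ := horb ρ hρ hρ₁ 0
  obtain ⟨η, hη0, hη, hηd, hηT⟩ := horbU _ (hmem 0).1 fun h => by
    have := congrArg Prod.snd h
    simp [planeChart, hρ.ne', (Real.exp_pos _).ne'] at this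
  have heq : γ = η := ODE_solution_unique_univ (v := fun _ => field f g) (s := fun _ => W)
    (K := K) (t₀ := 0) (fun _ => hLip)
    (fun t => ⟨hγd t, by obtain ⟨α, hα⟩ := hγ t; rw [hα]; exact (hmem α).2⟩)
    (fun t => ⟨hηd t, hUW (hη t)⟩) (hγ0.trans hη0.symm)
  rw [heq] at hγT
  exact hγT.unique hηT

theorem odd_of_isIsochronousCenter (c : IsUrabeChart f g ξ H) (hf : AnalyticAt ℝ f 0)
    (hg : AnalyticAt ℝ g 0) (hcen : IsIsochronousCenter (field f g) (0, 0)) :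
    ∀ᶠ s in 𝓝 (0 : ℝ), H (-s) = -H s := by
  obtain ⟨T, hT⟩ := c.exists_period_eq hf hg hcen
  obtain ⟨r, hr, hcont⟩ := c.analyticAt_urabe.exists_continuousOn_ball
  -- Chosen so that `H(s) + H(-s) - K` has zero mean: its integral over a circle is `2 (T - 2π) - 2π
  -- K`.
  set K : ℝ := (T - 2 * Real.pi) / Real.pi with hK
  have hneg : AnalyticAt ℝ (fun s => H (-s)) 0 :=
    AnalyticAt.comp (g := H) (f := fun s => -s) (by simpa using c.analyticAt_urabe)
      analyticAt_id.neg
  have he := eventually_eq_zero_of_integral_mul_sin (e := fun s => H s + H (-s) - K)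
    ((c.analyticAt_urabe.add hneg).sub analyticAt_const)
    (fun s => by simp only [neg_neg, add_comm]) (by
      filter_upwards [hT, Ioo_mem_nhdsGT hr] with ρ h1 hρ
      have hc := (continuous_comp_mul_sin hcont hρ.1 hρ.2).intervalIntegrable 0 (2 * Real.pi)
        (μ := MeasureTheory.volume)
      have hc' : IntervalIntegrable (fun α => H (-(ρ * Real.sin α))) MeasureTheory.volume
          0 (2 * Real.pi) := by
        refine Continuous.intervalIntegrable ?_ _ _
        have := (continuous_comp_mul_sin hcont hρ.1 hρ.2).comp (continuous_neg (G := ℝ))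
        simpa [Function.comp_def] using this
      rw [intervalIntegral.integral_add (by simp) hc] at h1
      rw [intervalIntegral.integral_sub (hc.add hc') (by simp),
        intervalIntegral.integral_add hc hc', integral_comp_neg_mul_sin]
      simp only [intervalIntegral.integral_const, smul_eq_mul, sub_zero, mul_one] at h1 ⊢
      rw [hK]
      field_simp
      linarith)
  have hK0 : K = 0 := by
    have := he.self_of_nhds
    simp only [neg_zero, c.urabe_zero] at this
    linarith
  filter_upwards [he] with s hs
  rw [hK0] at hs
  linarith

end IsUrabeChart

end Lienard

theorem mainTheorem1 (f g : ℝ → ℝ) (hf : AnalyticAt ℝ f 0) (hg : AnalyticAt ℝ g 0)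
    (hpos : ∀ᶠ x in 𝓝[≠] (0 : ℝ), 0 < x * g x) (hg1 : deriv g 0 = 1) :
    (Lienard.IsIsochronousCenter (Lienard.field f g) (0, 0) ↔
      ∃ h : ℝ → ℝ, Lienard.IsUrabeFunction f g h) ∧
    (∀ h : ℝ → ℝ, Lienard.IsUrabeFunction f g h → AnalyticAt ℝ h 0) ∧
    ((∀ᶠ x in 𝓝 (0 : ℝ), f (-x) = -f x) → (∀ᶠ x in 𝓝 (0 : ℝ), g (-x) = -g x) →
      (Lienard.IsIsochronousCenter (Lienard.field f g) (0, 0) ↔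
        ∀ᶠ x in 𝓝 (0 : ℝ), g x = Real.exp (-Lienard.F f x) * Lienard.phi f x) ∧
      (Lienard.IsIsochronousCenter (Lienard.field f g) (0, 0) ↔
        Lienard.IsUrabeFunction f g (fun _ => 0)) ∧
      (∀ h : ℝ → ℝ, Lienard.IsUrabeFunction f g h → ∀ᶠ s in 𝓝 (0 : ℝ), h s = 0)) := by
  obtain ⟨ξ, H, c⟩ := Lienard.exists_isUrabeChart hf hg hpos hg1
  have hX := (Lienard.analyticAt_X hf hg hpos hg1).1
  have hiff : Lienard.IsIsochronousCenter (Lienard.field f g) (0, 0) ↔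
      ∃ h : ℝ → ℝ, Lienard.IsUrabeFunction f g h := by
    rw [c.exists_isUrabeFunction_iff hX]
    exact ⟨c.odd_of_isIsochronousCenter hf hg,
      c.isIsochronousCenter_of_odd hf hX (Lienard.g_zero hg hpos)⟩
  refine ⟨hiff, fun h hh => c.analyticAt_urabe.congr (c.eventuallyEq_of_isUrabeFunction hh).symm,
    fun hfo hgo => ?_⟩
  have hvanish : ∀ h : ℝ → ℝ, Lienard.IsUrabeFunction f g h → ∀ᶠ s in 𝓝 (0 : ℝ), h s = 0 :=
    fun h hh => hh.eventually_eq_zero_of_odd c hfo hgo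
  have hzero : Lienard.IsIsochronousCenter (Lienard.field f g) (0, 0) ↔
      Lienard.IsUrabeFunction f g (fun _ => 0) :=
    hiff.trans ⟨fun ⟨h, hh⟩ => hh.zero_of_eventually_eq_zero hX (hvanish h hh), fun hh => ⟨_, hh⟩⟩
  exact ⟨hzero.trans (Lienard.isUrabeFunction_zero_iff hf hg), hzero, hvanish⟩
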